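/- For a bounded set $P\subset\mathbb{R}^2$ let $\sigma_P(x,y)=\sum_{(m,n)\in P\cap\mathbb{Z}^2}x^m y^n$ be its integer-point transform. For a linear function $F(X)=\frac{mX+t}{q}$, written with integers $m$ and $q>0$ (not necessarily coprime) and $t\in\mathbb{R}$, let $$\mathrm{RC}(u,v,s,F)=\sum_{k=\lceil s\rceil}^{\lceil s\rceil+q-1}u^{\lfloor F(k)\rfloor}v^k$$ be the Rademacher--Carlitz polynomial, which depends on the chosen denominator $q$. Theorem. Let $a,b,c,d,e,f,g,h$ be positive integers with $\frac ef<\frac ab$ and $\frac gh<\frac cd$, and let $\Delta$ be the (closed, solid) right triangle with vertices $(\frac ef,\frac gh)$, $(\frac ab,\frac gh)$, $(\frac ef,\frac cd)$. Set $\alpha=dh(be-af)<0$ and $\beta=bf(ch-dg)>0$, and let $l(X)=\frac{\beta}{\alpha}X+\frac cd-\frac{e\beta}{f\alpha}$, whose graph is the line through the hypotenuse of $\Delta$. Write $l^{-1}$ with denominator $\beta$ and $l$ with denominator $|\alpha|=-\alpha$. Then $\Delta$ contains finitely many lattice points, and $$\sigma_\Delta(x,y)=\frac{x^{\lceil e/f\rceil}y^{\lceil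 g/h\rceil}}{(1-x)(1-y)}+\frac{\mathrm{RC}(x,y,\frac gh,l^{-1})}{(1-x^{-1})(1-x^{\alpha}y^{\beta})}+\frac{\mathrm{RC}(y,x,\frac ef,l)}{(1-y^{-1})(1-x^{-\alpha}y^{-\beta})}$$ as an identity of rational functions in $x,y$ over $\mathbb{Q}$, and also as an identity of values for all nonzero elements $x,y$ of any field with $x\ne1$, $y\ne1$ and $x^{\alpha}y^{\beta}\neq1$. -/

import Mathlib

/-- The lattice points of a subset of the plane. -/
def latticePoints (P : Set (ℝ × ℝ)) : Set (ℤ × ℤ) :=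
  {p | ((p.1 : ℝ), (p.2 : ℝ)) ∈ P}

/-- The integer-point transform `σ_P(x, y) = ∑_{(m, n) ∈ P ∩ ℤ²} x ^ m y ^ n` of a bounded subset
of the plane (a set with finitely many lattice points). Exponents may be negative. -/
noncomputable def integerPointTransform {K : Type*} [Field K] (P : Set (ℝ × ℝ)) (x y : K) : K :=
  ∑ᶠ p ∈ latticePoints P, x ^ p.1 * y ^ p.2

/-- The Rademacher–Carlitz polynomial `RC(u, v, s, f) = ∑_{k = ⌈s⌉}^{⌈s⌉ + b - 1} u ^ ⌊f k⌋ v ^ k`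
of a linear function `f` that is written as `f X = (m * X + t) / b` with integers `m`, `b`, `b > 0`,
and a real number `t`. The sum depends on the denominator `b` of this expression, which is not
required to be in lowest terms, so `b` is an explicit argument. -/
noncomputable def RC {K : Type*} [Field K] (u v : K) (s : ℝ) (f : ℝ → ℝ) (b : ℤ) : K :=
  ∑ k ∈ Finset.Ico ⌈s⌉ (⌈s⌉ + b), u ^ ⌊f (k : ℝ)⌋ * v ^ k

/-! Brion's identity is proved by a closed walk instead of cone generating functions. Let `D M N` be
the lattice-point sum minus the cone sum for the corner `(M, N)`. Deleting a bottom row or a left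
column changes both sums equally (`cornerSum_sub_row`, `coneSum_sub_row` and the swap lemmas), so
`D` is constant along unit steps near the region under the hypotenuse. Translation by the period
`(-q, p)` multiplies `D` by `z = x ^ (-q) * y ^ p`. Walking `q` steps left and `p` steps up gives `D
= z * D`, and `z ≠ 1` forces `D = 0`. Only periodicity and the Galois-type relation between `U` and
`V` are used, so `p` and `q` need not be coprime. -/

/-- The lattice points with `m ≥ M` and `n ≥ N` in the region `m ≤ U n`. -/
def cornerPoints (U : ℤ → ℤ) (M N : ℤ) : Set (ℤ × ℤ) :=
  {r | M ≤ r.1 ∧ N ≤ r.2 ∧ r.1 ≤ U r.2}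

/-- The sum of the three vertex cone transforms of the triangle cut out by `m ≥ M`, `n ≥ N` and
`m ≤ U n` (equivalently `n ≤ V m`), whose hypotenuse has direction `(-q, p)`. -/
noncomputable def coneSum {K : Type*} [Field K] (x y : K) (U V : ℤ → ℤ) (p q M N : ℤ) : K :=
  x ^ M * y ^ N / ((1 - x) * (1 - y))
    + (∑ n ∈ Finset.Ico N (N + p), x ^ U n * y ^ n) / ((1 - x⁻¹) * (1 - x ^ (-q) * y ^ p))
    + (∑ m ∈ Finset.Ico M (M + q), y ^ V m * x ^ m) / ((1 - y⁻¹) * (1 - x ^ q * y ^ (-p)))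

/-- The integer-point transform of `cornerPoints`. -/
noncomputable def cornerSum {K : Type*} [Field K] (x y : K) (U : ℤ → ℤ) (M N : ℤ) : K :=
  ∑ᶠ r ∈ cornerPoints U M N, x ^ r.1 * y ^ r.2

/-! ### Staircase regions: row deletion, symmetry, translation -/

section Staircase

variable {K : Type*} [Field K] {x y : K} {U V : ℤ → ℤ} {p q M N : ℤ}

theorem antitone_of_le_iff (hUV : ∀ m n, m ≤ U n ↔ n ≤ V m) : Antitone U := fun _ _ hn =>
  (hUV _ _).2 (hn.trans ((hUV _ _).1 le_rfl))

theorem finite_cornerPoints (hUV : ∀ m n, m ≤ U n ↔ n ≤ V m) (M N : ℤ) :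
    (cornerPoints U M N).Finite := by
  refine ((Set.finite_Icc M (U N)).prod (Set.finite_Icc N (V M))).subset ?_
  rintro ⟨m, n⟩ ⟨h₁, h₂, h₃⟩
  refine ⟨⟨h₁, h₃.trans (antitone_of_le_iff hUV h₂)⟩, h₂, ?_⟩
  exact (hUV _ _).1 (h₁.trans h₃)

theorem sum_Ico_zpow_mul (hx : x ≠ 0) {L : ℤ} (h : M ≤ L) :
    (∑ m ∈ Finset.Ico M L, x ^ m) * (1 - x) = x ^ M - x ^ L := by
  induction L, h using Int.leInduction with
  | base => simp
  | succ L hL ih =>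
    rw [← Finset.insert_Ico_right_eq_Ico_add_one hL, Finset.sum_insert (by simp), add_mul, ih,
      zpow_add_one₀ hx]
    ring

theorem sum_Ico_add_period (F : ℤ → K) (hp : 0 < p) :
    ∑ n ∈ Finset.Ico N (N + p), F n + F (N + p)
      = F N + ∑ n ∈ Finset.Ico (N + 1) (N + 1 + p), F n := by
  have h₁ : Finset.Ico N (N + p + 1) = insert (N + p) (Finset.Ico N (N + p)) :=
    (Finset.insert_Ico_right_eq_Ico_add_one (by lia)).symm
  have h₂ : Finset.Ico N (N + p + 1) = insert N (Finset.Ico (N + 1) (N + p + 1)) := by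
    ext k; simp only [Finset.mem_insert, Finset.mem_Ico]; lia
  have h := congrArg (fun s => ∑ n ∈ s, F n) (h₁.symm.trans h₂)
  rw [Finset.sum_insert (by simp), Finset.sum_insert (by simp)] at h
  rw [add_comm, h, add_right_comm]

theorem cornerSum_sub_row (hUV : ∀ m n, m ≤ U n ↔ n ≤ V m) :
    cornerSum x y U M N =
      (∑ m ∈ Finset.Ico M (U N + 1), x ^ m) * y ^ N + cornerSum x y U M (N + 1) := by
  have hset : cornerPoints U M N =
      (((Finset.Ico M (U N + 1)).image fun m => (m, N) : Finset (ℤ × ℤ)) : Set (ℤ × ℤ)) ∪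
        cornerPoints U M (N + 1) := by
    ext ⟨m, n⟩
    simp only [cornerPoints, Set.mem_ofPred_eq, Set.mem_union, Finset.coe_image, Set.mem_image,
      Finset.coe_Ico, Set.mem_Ico, Prod.mk.injEq]
    constructor
    · rintro ⟨h₁, h₂, h₃⟩
      rcases h₂.eq_or_lt with rfl | h
      · exact Or.inl ⟨m, ⟨h₁, by lia⟩, rfl, rfl⟩
      · exact Or.inr ⟨h₁, h, h₃⟩
    · rintro (⟨k, ⟨h₁, h₂⟩, rfl, rfl⟩ | ⟨h₁, h₂, h₃⟩)
      · exact ⟨h₁, le_rfl, by lia⟩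
      · exact ⟨h₁, by lia, h₃⟩
  rw [cornerSum, hset, finsum_mem_union _ (Finset.finite_toSet _) (finite_cornerPoints hUV _ _),
    finsum_mem_coe_finset, Finset.sum_image (by simp), Finset.sum_mul]
  · rfl
  · rw [Set.disjoint_left]
    rintro ⟨m, n⟩ h₁ ⟨_, h₂, _⟩
    simp only [Finset.coe_image, Set.mem_image, Prod.mk.injEq] at h₁ h₂
    obtain ⟨_, _, _, rfl⟩ := h₁
    lia

/-- Sliding the window of `p` terms up by one trades `x ^ U N * y ^ N` for `z` times itself; the
factor `1 - z` cancels, leaving the upper end of the geometric row sum. The first cone supplies the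
lower end. Equality in `hle` is the empty row. -/
theorem coneSum_sub_row (hx : x ≠ 0) (hy : y ≠ 0) (hx1 : x ≠ 1) (hy1 : y ≠ 1)
    (hz : x ^ (-q) * y ^ p ≠ 1) (hp : 0 < p) (hU : ∀ n, U (n + p) = U n - q)
    (hle : M ≤ U N + 1) :
    coneSum x y U V p q M N =
      (∑ m ∈ Finset.Ico M (U N + 1), x ^ m) * y ^ N + coneSum x y U V p q M (N + 1) := by
  have h1x : 1 - x ≠ 0 := sub_ne_zero.2 hx1.symm
  have h1y : 1 - y ≠ 0 := sub_ne_zero.2 hy1.symm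
  have h1z : 1 - x ^ (-q) * y ^ p ≠ 0 := sub_ne_zero.2 hz.symm
  have hx' : x - 1 ≠ 0 := sub_ne_zero.2 hx1
  have hrow : ∑ m ∈ Finset.Ico M (U N + 1), x ^ m = (x ^ M - x ^ (U N + 1)) / (1 - x) :=
    eq_div_of_mul_eq h1x (sum_Ico_zpow_mul hx hle)
  have hper := sum_Ico_add_period (N := N) (fun n => x ^ U n * y ^ n) hp
  have hlast : x ^ U (N + p) * y ^ (N + p) = x ^ U N * y ^ N * (x ^ (-q) * y ^ p) := by
    rw [hU, sub_eq_add_neg, zpow_add₀ hx, zpow_add₀ hy]; ring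
  simp only [hlast] at hper
  have hsum : ∑ n ∈ Finset.Ico N (N + p), x ^ U n * y ^ n =
      x ^ U N * y ^ N * (1 - x ^ (-q) * y ^ p)
        + ∑ n ∈ Finset.Ico (N + 1) (N + 1 + p), x ^ U n * y ^ n := by
    linear_combination hper
  have hxi : 1 - x⁻¹ = (x - 1) / x := by field_simp
  rw [coneSum, coneSum, hsum, hrow, zpow_add_one₀ hx, zpow_add_one₀ hy, hxi]
  generalize (∑ n ∈ Finset.Ico (N + 1) (N + 1 + p), x ^ U n * y ^ n) = A
  generalize (∑ m ∈ Finset.Ico M (M + q), y ^ V m * x ^ m) /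
    ((1 - y⁻¹) * (1 - x ^ q * y ^ (-p))) = B
  generalize x ^ (-q) * y ^ p = z at *
  generalize x ^ M = s
  generalize y ^ N = t
  generalize x ^ U N = u
  have e₁ : s * t / ((1 - x) * (1 - y)) =
      s * t / (1 - x) + s * (t * y) / ((1 - x) * (1 - y)) := by field_simp; ring
  have e₂ : (u * t * (1 - z) + A) / ((x - 1) / x * (1 - z)) =
      - (u * x * t) / (1 - x) + A / ((x - 1) / x * (1 - z)) := by
    rw [add_div, mul_div_mul_right _ _ h1z, div_div_eq_mul_div, ← neg_sub 1 x, div_neg, neg_div]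
    ring
  rw [e₁, e₂]
  ring

/-- Reflection in the diagonal turns row deletion into column deletion. -/
theorem coneSum_swap : coneSum x y U V p q M N = coneSum y x V U q p N M := by
  simp only [coneSum, mul_comm]
  ring

theorem cornerSum_swap (hUV : ∀ m n, m ≤ U n ↔ n ≤ V m) :
    cornerSum x y U M N = cornerSum y x V N M := by
  refine finsum_mem_eq_of_bijOn Prod.swap ⟨?_, Prod.swap_injective.injOn, ?_⟩ ?_
  · rintro ⟨m, n⟩ ⟨h₁, h₂, h₃⟩
    exact ⟨h₂, h₁, (hUV _ _).1 h₃⟩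
  · rintro ⟨n, m⟩ ⟨h₁, h₂, h₃⟩
    exact ⟨(m, n), ⟨h₂, h₁, (hUV _ _).2 h₃⟩, rfl⟩
  · intro r _
    exact mul_comm _ _

theorem cornerSum_translate (hx : x ≠ 0) (hy : y ≠ 0) (hU : ∀ n, U (n + p) = U n - q) :
    cornerSum x y U (M - q) (N + p) = x ^ (-q) * y ^ p * cornerSum x y U M N := by
  rw [cornerSum, cornerSum, mul_finsum_mem]
  refine (finsum_mem_eq_of_bijOn (fun r : ℤ × ℤ => (r.1 - q, r.2 + p)) ⟨?_, ?_, ?_⟩ ?_).symm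
  · rintro ⟨m, n⟩ ⟨h₁, h₂, h₃⟩
    refine ⟨?_, ?_, ?_⟩ <;> simp only [hU] at * <;> lia
  · rintro ⟨m, n⟩ _ ⟨m', n'⟩ _ h
    simpa using h
  · rintro ⟨m, n⟩ ⟨h₁, h₂, h₃⟩
    have := hU (n - p)
    simp only [sub_add_cancel] at this h₁ h₂ h₃
    refine ⟨(m + q, n - p), ⟨?_, ?_, ?_⟩, by simp⟩ <;> simp only <;> lia
  · rintro ⟨m, n⟩ _
    simp only [sub_eq_add_neg, zpow_add₀ hx, zpow_add₀ hy]
    ring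

theorem sum_Ico_translate (F : ℤ → K) (M L s : ℤ) :
    ∑ m ∈ Finset.Ico (M + s) (L + s), F m = ∑ m ∈ Finset.Ico M L, F (m + s) := by
  rw [← Finset.image_add_right_Ico, Finset.sum_image (by simp)]

theorem coneSum_translate (hx : x ≠ 0) (hy : y ≠ 0) (hU : ∀ n, U (n + p) = U n - q)
    (hV : ∀ m, V (m + q) = V m - p) :
    coneSum x y U V p q (M - q) (N + p) = x ^ (-q) * y ^ p * coneSum x y U V p q M N := by
  have hV' : ∀ m, V (m + -q) = V m + p := fun m => by
    have := hV (m + -q)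
    rw [neg_add_cancel_right] at this
    lia
  have h₁ : ∑ n ∈ Finset.Ico (N + p) (N + p + p), x ^ U n * y ^ n =
      x ^ (-q) * y ^ p * ∑ n ∈ Finset.Ico N (N + p), x ^ U n * y ^ n := by
    rw [sum_Ico_translate, Finset.mul_sum]
    refine Finset.sum_congr rfl fun n _ => ?_
    rw [hU, sub_eq_add_neg, zpow_add₀ hx, zpow_add₀ hy]
    ring
  have h₂ : ∑ m ∈ Finset.Ico (M - q) (M - q + q), y ^ V m * x ^ m =
      x ^ (-q) * y ^ p * ∑ m ∈ Finset.Ico M (M + q), y ^ V m * x ^ m := by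
    rw [show M - q + q = M + q + -q by ring, sub_eq_add_neg, sum_Ico_translate, Finset.mul_sum]
    refine Finset.sum_congr rfl fun m _ => ?_
    rw [hV', zpow_add₀ hx, zpow_add₀ hy]
    ring
  rw [coneSum, coneSum, h₁, h₂, sub_eq_add_neg M q, zpow_add₀ hx, zpow_add₀ hy]
  ring

/-- Brion's identity for a corner whose south-western neighbour `(M - 1, N - 1)` lies in the
region below the hypotenuse. -/
theorem cornerSum_eq_coneSum (hx : x ≠ 0) (hy : y ≠ 0) (hx1 : x ≠ 1) (hy1 : y ≠ 1)
    (hz : x ^ (-q) * y ^ p ≠ 1) (hp : 0 < p) (hq : 0 < q)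
    (hUV : ∀ m n, m ≤ U n ↔ n ≤ V m) (hU : ∀ n, U (n + p) = U n - q)
    (hV : ∀ m, V (m + q) = V m - p) (hMN : M - 1 ≤ U (N - 1)) :
    cornerSum x y U M N = coneSum x y U V p q M N := by
  have hz' : y ^ (-p) * x ^ q ≠ 1 := fun h => hz <| by
    rw [← inv_inj, mul_inv, ← zpow_neg, ← zpow_neg, neg_neg, mul_comm, h, inv_one]
  let D : ℤ → ℤ → K := fun M N => cornerSum x y U M N - coneSum x y U V p q M N
  have up : ∀ M N, M - 1 ≤ U N → D M N = D M (N + 1) := fun M N h => by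
    simp only [D]
    rw [cornerSum_sub_row hUV, coneSum_sub_row hx hy hx1 hy1 hz hp hU (by lia)]
    ring
  have right : ∀ M N, M ≤ U (N - 1) → D M N = D (M + 1) N := fun M N h => by
    have := (hUV _ _).1 h
    simp only [D]
    rw [cornerSum_swap hUV, cornerSum_swap hUV, coneSum_swap, coneSum_swap (M := M + 1),
      cornerSum_sub_row fun m n => (hUV n m).symm, coneSum_sub_row hy hx hy1 hx1 hz' hq hV (by lia)]
    ring
  have hleft : ∀ k : ℕ, D (M - k) N = D M N := fun k => by
    induction k with
    | zero => simp
    | succ k ih =>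
      rw [right _ _ (by push_cast; lia), ← ih]
      congr 1
      push_cast
      ring
  have hup : ∀ k : ℕ, (k : ℤ) ≤ p → D (M - q) (N + k) = D (M - q) N := fun k => by
    induction k with
    | zero => simp
    | succ k ih =>
      intro hk
      push_cast at hk
      rw [← ih (by lia), up _ (N + k)]
      · push_cast
        rw [add_assoc]
      -- `hMN` shifted by one period bounds `U` at height `N - 1 + p`, the highest row deleted.
      · have h₁ : U (N - 1 + p) ≤ U (N + k) := antitone_of_le_iff hUV (by lia)
        rw [hU] at h₁
        lia
  have hl := hleft q.toNat
  have hu := hup p.toNat (by lia)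
  rw [Int.toNat_of_nonneg hq.le] at hl
  rw [Int.toNat_of_nonneg hp.le, hl] at hu
  have htr : D (M - q) (N + p) = x ^ (-q) * y ^ p * D M N := by
    simp only [D]
    rw [cornerSum_translate hx hy hU, coneSum_translate hx hy hU hV]
    ring
  have h0 : (x ^ (-q) * y ^ p - 1) * D M N = 0 := by
    rw [sub_mul, one_mul, ← htr, hu, sub_self]
  exact sub_eq_zero.1 ((mul_eq_zero.1 h0).resolve_left (sub_ne_zero.2 hz))

end Staircase

/-! ### The triangle and the field of rational functions -/

/-- A right triangle with legs parallel to the axes, described by inequalities. -/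
theorem mem_convexHull_right_triangle {x₀ x₁ y₀ y₁ : ℝ} (hx : x₀ < x₁) (hy : y₀ < y₁)
    (r : ℝ × ℝ) :
    r ∈ convexHull ℝ {(x₀, y₀), (x₁, y₀), (x₀, y₁)} ↔
      x₀ ≤ r.1 ∧ y₀ ≤ r.2 ∧ (r.1 - x₀) * (y₁ - y₀) + (r.2 - y₀) * (x₁ - x₀)
        ≤ (x₁ - x₀) * (y₁ - y₀) := by
  have hx' := sub_pos.2 hx
  have hy' := sub_pos.2 hy
  constructor
  · intro h
    refine convexHull_min (t := {r : ℝ × ℝ | x₀ ≤ r.1 ∧ y₀ ≤ r.2 ∧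
      (r.1 - x₀) * (y₁ - y₀) + (r.2 - y₀) * (x₁ - x₀) ≤ (x₁ - x₀) * (y₁ - y₀)}) ?_ ?_ h
    · rintro r (rfl | rfl | rfl)
      · exact ⟨le_rfl, le_rfl, by simpa using (mul_pos hx' hy').le⟩
      · exact ⟨hx.le, le_rfl, by simp⟩
      · exact ⟨le_rfl, hy.le, by simp [mul_comm]⟩
    · rintro ⟨m, n⟩ ⟨h₁, h₂, h₃⟩ ⟨m', n'⟩ ⟨h₁', h₂', h₃'⟩ s t hs ht hst
      obtain rfl : t = 1 - s := by linarith
      simp only [Set.mem_ofPred_eq, Prod.smul_mk, Prod.mk_add_mk, smul_eq_mul] at *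
      refine ⟨?_, ?_, ?_⟩
      · linarith [mul_le_mul_of_nonneg_left h₁ hs, mul_le_mul_of_nonneg_left h₁' ht]
      · linarith [mul_le_mul_of_nonneg_left h₂ hs, mul_le_mul_of_nonneg_left h₂' ht]
      · linarith [mul_le_mul_of_nonneg_left h₃ hs, mul_le_mul_of_nonneg_left h₃' ht]
  · obtain ⟨X, Y⟩ := r
    rintro ⟨h₁, h₂, h₃⟩
    simp only at h₁ h₂ h₃
    have hs : (X - x₀) / (x₁ - x₀) + (Y - y₀) / (y₁ - y₀) ≤ 1 := by
      rw [div_add_div _ _ hx'.ne' hy'.ne', div_le_one (mul_pos hx' hy')]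
      linarith
    have := (convex_convexHull ℝ {(x₀, y₀), (x₁, y₀), (x₀, y₁)}).sum_mem
      (t := Finset.univ)
      (w := ![1 - (X - x₀) / (x₁ - x₀) - (Y - y₀) / (y₁ - y₀), (X - x₀) / (x₁ - x₀),
        (Y - y₀) / (y₁ - y₀)])
      (z := ![(x₀, y₀), (x₁, y₀), (x₀, y₁)]) ?_ ?_ ?_
    · convert this using 1
      simp only [Fin.sum_univ_three, Matrix.cons_val, Prod.smul_mk, Prod.mk_add_mk, smul_eq_mul,
        Prod.mk.injEq]
      constructor <;> field_simp <;> ring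
    · intro i _
      fin_cases i
      · simp; linarith
      · exact div_nonneg (sub_nonneg.2 h₁) hx'.le
      · exact div_nonneg (sub_nonneg.2 h₂) hy'.le
    · simp only [Fin.sum_univ_three, Matrix.cons_val]
      ring
    · intro i _
      refine subset_convexHull ℝ _ ?_
      fin_cases i <;> simp

/-- The two coordinates of `ℚ(X, Y)` are multiplicatively independent. -/
theorem algebraMap_X_zpow_mul_zpow_ne_one {p q : ℤ} (hp : 0 ≤ p) (hq : 0 < q) :
    algebraMap (MvPolynomial (Fin 2) ℚ) (FractionRing (MvPolynomial (Fin 2) ℚ))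
        (MvPolynomial.X 0) ^ (-q) *
      algebraMap (MvPolynomial (Fin 2) ℚ) (FractionRing (MvPolynomial (Fin 2) ℚ))
        (MvPolynomial.X 1) ^ p ≠ 1 := by
  have hinj := IsFractionRing.injective (MvPolynomial (Fin 2) ℚ)
    (FractionRing (MvPolynomial (Fin 2) ℚ))
  intro h
  lift p to ℕ using hp
  lift q to ℕ using hq.le
  rw [zpow_neg, inv_mul_eq_one₀, zpow_natCast, zpow_natCast, ← map_pow, ← map_pow] at h
  · have h' := congrArg (MvPolynomial.eval ![(0 : ℚ), 1]) (hinj h)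
    have hq' : q ≠ 0 := by lia
    simp [hq'] at h'
  · refine zpow_ne_zero _ ((map_ne_zero_iff _ hinj).2 (MvPolynomial.X_ne_zero _))

theorem theorem2
    (a b c d e f g h : ℤ)
    (ha : 0 < a) (hb : 0 < b) (hc : 0 < c) (hd : 0 < d)
    (he : 0 < e) (hf : 0 < f) (hg : 0 < g) (hh : 0 < h)
    -- the right angle is the south-western vertex of the triangle
    (hx : (e / f : ℝ) < a / b) (hy : (g / h : ℝ) < c / d)
    (Δ : Set (ℝ × ℝ))
    (hΔ : Δ = convexHull ℝ {((e / f : ℝ), (g / h : ℝ)), ((a / b : ℝ), (g / h : ℝ)),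
      ((e / f : ℝ), (c / d : ℝ))})
    (α β : ℤ) (hα : α = d * h * (b * e - a * f)) (hβ : β = b * f * (c * h - d * g))
    -- the line through the hypotenuse, as a function of the first coordinate, and its inverse
    (l linv : ℝ → ℝ)
    (hl : ∀ X : ℝ, l X = (β / α : ℝ) * X + c / d - (e * β) / (f * α))
    (hlinv : Function.LeftInverse linv l) (hlinv' : Function.RightInverse linv l) :
    (latticePoints Δ).Finite ∧
    -- the identity in the field of rational functions in two variables
    (∀ x y : FractionRing (MvPolynomial (Fin 2) ℚ),
      x = algebraMap (MvPolynomial (Fin 2) ℚ) _ (MvPolynomial.X 0) →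
      y = algebraMap (MvPolynomial (Fin 2) ℚ) _ (MvPolynomial.X 1) →
      integerPointTransform Δ x y =
        x ^ ⌈(e / f : ℝ)⌉ * y ^ ⌈(g / h : ℝ)⌉ / ((1 - x) * (1 - y))
        + RC x y (g / h) linv β / ((1 - x⁻¹) * (1 - x ^ α * y ^ β))
        + RC y x (e / f) l |α| / ((1 - y⁻¹) * (1 - x ^ (-α) * y ^ (-β)))) ∧
    -- the identity of values, wherever no denominator vanishes
    (∀ (K : Type*) [Field K] (x y : K), x ≠ 0 → y ≠ 0 → x ≠ 1 → y ≠ 1 → x ^ α * y ^ β ≠ 1 →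
      integerPointTransform Δ x y =
        x ^ ⌈(e / f : ℝ)⌉ * y ^ ⌈(g / h : ℝ)⌉ / ((1 - x) * (1 - y))
        + RC x y (g / h) linv β / ((1 - x⁻¹) * (1 - x ^ α * y ^ β))
        + RC y x (e / f) l |α| / ((1 - y⁻¹) * (1 - x ^ (-α) * y ^ (-β)))) := by
  have hbR : (0 : ℝ) < b := by exact_mod_cast hb
  have hdR : (0 : ℝ) < d := by exact_mod_cast hd
  have hfR : (0 : ℝ) < f := by exact_mod_cast hf
  have hhR : (0 : ℝ) < h := by exact_mod_cast hh
  have hαR : (α : ℝ) = -(d * h * b * f * (a / b - e / f)) := by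
    rw [hα]; push_cast; field_simp; ring
  have hβR : (β : ℝ) = b * f * d * h * (c / d - g / h) := by
    rw [hβ]; push_cast; field_simp
  have hα0 : (α : ℝ) < 0 := by
    rw [hαR]
    have := sub_pos.2 hx
    exact neg_neg_of_pos (by positivity)
  have hβ0 : (0 : ℝ) < β := by
    rw [hβR]
    have := sub_pos.2 hy
    positivity
  have hαZ : α < 0 := by exact_mod_cast hα0
  have hβZ : 0 < β := by exact_mod_cast hβ0
  have hl' : ∀ X, l X = β / α * (X - e / f) + c / d := fun X => by
    rw [hl]; field_simp [hα0.ne]; ring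
  have hli : ∀ Y, linv Y = α / β * (Y - c / d) + e / f := fun Y => by
    have h₁ := hlinv' Y
    rw [hl'] at h₁
    have h₂ : Y - c / d = β / α * (linv Y - e / f) := by linarith
    rw [h₂, ← mul_assoc, div_mul_div_cancel₀ hβ0.ne', div_self hα0.ne]
    ring
  -- Both floor functions test the same half-plane, which yields `hUV`.
  have hle : ∀ X Y, X ≤ linv Y ↔ β * (X - e / f) ≤ α * (Y - c / d) := fun X Y => by
    rw [hli, ← sub_le_iff_le_add, div_mul_eq_mul_div, le_div_iff₀ hβ0, mul_comm]
  have hle' : ∀ X Y, Y ≤ l X ↔ β * (X - e / f) ≤ α * (Y - c / d) := fun X Y => by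
    rw [hl', ← sub_le_iff_le_add, div_mul_eq_mul_div, le_div_iff_of_neg hα0, mul_comm (α : ℝ)]
  set U : ℤ → ℤ := fun n => ⌊linv (n : ℝ)⌋ with hUdef
  set V : ℤ → ℤ := fun m => ⌊l (m : ℝ)⌋ with hVdef
  have hUV : ∀ m n, m ≤ U n ↔ n ≤ V m := fun m n => by
    rw [hUdef, hVdef, Int.le_floor, Int.le_floor, hle, hle']
  have hU : ∀ n, U (n + β) = U n - -α := fun n => by
    have h₁ : linv ((n + β : ℤ) : ℝ) = linv n + α := by
      rw [hli, hli]; push_cast; field_simp; ring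
    simp only [hUdef]
    rw [h₁, Int.floor_add_intCast, sub_neg_eq_add]
  have hV : ∀ m, V (m + -α) = V m - β := fun m => by
    have h₁ : l ((m + -α : ℤ) : ℝ) = l m - β := by
      rw [hl', hl']; push_cast; field_simp [hα0.ne]; ring
    simp only [hVdef]
    rw [h₁, Int.floor_sub_intCast]
  have hlat : latticePoints Δ = cornerPoints U ⌈(e / f : ℝ)⌉ ⌈(g / h : ℝ)⌉ := by
    ext ⟨m, n⟩
    simp only [latticePoints, cornerPoints, Set.mem_ofPred_eq, hΔ,
      mem_convexHull_right_triangle hx hy, Int.ceil_le, hUdef, Int.le_floor, hle]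
    refine and_congr_right fun _ => and_congr_right fun _ => ?_
    rw [hαR, hβR, ← sub_nonneg, ← sub_nonneg (b := (b * f * d * h * (c / d - g / h) : ℝ) * _)]
    have hpos : (0 : ℝ) < b * f * d * h := by positivity
    rw [← mul_nonneg_iff_of_pos_left hpos]
    refine iff_of_eq (congrArg (0 ≤ ·) ?_)
    ring
  -- Rounding up and subtracting one lands strictly south-west of the right angle, even if the
  -- triangle has no lattice points.
  have hcorner : ⌈(e / f : ℝ)⌉ - 1 ≤ U (⌈(g / h : ℝ)⌉ - 1) := by
    have h₁ := Int.ceil_lt_add_one (e / f : ℝ)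
    have h₂ := Int.ceil_lt_add_one (g / h : ℝ)
    rw [hUdef, Int.le_floor, hle]
    push_cast
    exact (mul_nonpos_of_nonneg_of_nonpos hβ0.le (by linarith)).trans
      (mul_nonneg_of_nonpos_of_nonpos hα0.le (by linarith))
  refine ⟨hlat ▸ finite_cornerPoints hUV _ _, ?_, ?_⟩
  · rintro x y rfl rfl
    have hinj := IsFractionRing.injective (MvPolynomial (Fin 2) ℚ)
      (FractionRing (MvPolynomial (Fin 2) ℚ))
    have hne1 : ∀ i : Fin 2, algebraMap (MvPolynomial (Fin 2) ℚ)
        (FractionRing (MvPolynomial (Fin 2) ℚ)) (MvPolynomial.X i) ≠ 1 := fun i hi => by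
      have := congrArg (MvPolynomial.eval 0) (hinj (hi.trans (map_one _).symm))
      simp at this
    have hne0 : ∀ i : Fin 2, algebraMap (MvPolynomial (Fin 2) ℚ)
        (FractionRing (MvPolynomial (Fin 2) ℚ)) (MvPolynomial.X i) ≠ 0 := fun i =>
      (map_ne_zero_iff _ hinj).2 (MvPolynomial.X_ne_zero _)
    have := cornerSum_eq_coneSum (hne0 0) (hne0 1) (hne1 0) (hne1 1)
      (algebraMap_X_zpow_mul_zpow_ne_one hβZ.le (neg_pos.2 hαZ)) hβZ (neg_pos.2 hαZ)
      hUV hU hV hcorner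
    rw [integerPointTransform, hlat, abs_of_neg hαZ]
    rwa [coneSum, neg_neg] at this
  · intro K _ x y hx0 hy0 hx1 hy1 hz
    have := cornerSum_eq_coneSum (q := -α) hx0 hy0 hx1 hy1 (by rwa [neg_neg]) hβZ
      (neg_pos.2 hαZ) hUV hU hV hcorner
    rw [integerPointTransform, hlat, abs_of_neg hαZ]
    rwa [coneSum, neg_neg] at this
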